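/- **Setting.** All manifolds, maps, tensors and vector fields are smooth. Let $(M,g,J)$ be a locally conformal Kähler manifold with Lee form $\omega$: $(M,g,J)$ is a Hermitian manifold (with $J$ integrable), and, with $\Omega(X,Y)=g(X,JY)$, $\omega$ is a closed $1$-form on $M$ such that $d\Omega=\omega\wedge\Omega$. Let $B_1$ be the Lee vector field, $g(X,B_1)=\omega(X)$. Let $\pi:(M,g)\to(N,g_N)$ be an anti-invariant Riemannian submersion onto a Riemannian manifold, that is, a surjective submersion whose differential $\pi_*$ preserves the lengths of vectors in $(\ker\pi_*)^\perp$ and which satisfies $J(\ker\pi_*)\subseteq(\ker\pi_*)^\perp$. Assume that $B_1$ is vertical, $B_1\in\Gamma(\ker\pi_*)$. Write $\mathcal V,\mathcal H$ for the orthogonal projections of $TM$ onto $\ker\pi_*$ and $(\ker\pi_*)^\perp$. For horizontal $X$ write $JX=BX+CX$ with $BX=\mathcal V JX$ and $CX=\mathcal H JX$. Let $\nabla$ be the Levi-Civita connection of $g$, let $\mathcal A_EF=\mathcal H\nabla_{\mathcal HE}\mathcal VF+\mathcal V\nabla_{\mathcal HE}\mathcal HF$ be O'Neill's tensor, and let $(\nabla\pi_*)(E,F)=\nabla^\pi_E(\pi_*F)-\pi_*(\nabla_EF)$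 be the second fundamental form of $\pi$, where $\nabla^\pi$ is the pullback of the Levi-Civita connection of $g_N$. **Theorem 3.3.** The following assertions are equivalent. (a) The distribution $(\ker\pi_*)^\perp$ is integrable, i.e. $[X,Y]\in\Gamma((\ker\pi_*)^\perp)$ for all $X,Y\in\Gamma((\ker\pi_*)^\perp)$. (b) For all $X,Y\in\Gamma((\ker\pi_*)^\perp)$ and $V\in\Gamma(\ker\pi_*)$, $$g_N\big((\nabla\pi_*)(Y,BX),\pi_*JV\big)=g_N\big((\nabla\pi_*)(X,BY),\pi_*JV\big)+g(CY,J\mathcal A_XV)-g(CX,J\mathcal A_YV)+\tfrac12 g(BY,B_1)\,g(X,JV)-\tfrac12 g(BX,B_1)\,g(Y,JV).$$ (c) For all $X,Y\in\Gamma((\ker\pi_*)^\perp)$ and $V\in\Gamma(\ker\pi_*)$, $$g(\mathcal A_YBX-\mathcal A_XBY,JV)=-g(CY,J\mathcal A_XV)+g(CX,J\mathcal A_YV)-\tfrac12 g(BY,B_1)\,g(X,JV)+\tfrac12 g(BX,B_1)\,g(Y,JV).$$ -/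

import Mathlib

open Bundle
open scoped Manifold ContDiff InnerProductSpace

noncomputable section

namespace RiemSubm

section LeviCivita

variable {E : Type*} [NormedAddCommGroup E] [NormedSpace ℝ E] [FiniteDimensional ℝ E]
  {M : Type*} [TopologicalSpace M] [ChartedSpace E M] [IsManifold 𝓘(ℝ, E) ∞ M]
  [RiemannianBundle (fun x : M => TangentSpace 𝓘(ℝ, E) x)]
  [IsContMDiffRiemannianBundle 𝓘(ℝ, E) ∞ E (fun x : M => TangentSpace 𝓘(ℝ, E) x)]

/-- The right-hand side of the Koszul formula for `g(∇_X Y, Z)`: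
`½ (X g(Y,Z) + Y g(Z,X) - Z g(X,Y) + g([X,Y],Z) - g([Y,Z],X) + g([Z,X],Y))`. -/
def koszul (X Y Z : Π x : M, TangentSpace 𝓘(ℝ, E) x) (x : M) : ℝ :=
  (1 / 2) * (mvfderiv 𝓘(ℝ, E) (fun q => ⟪Y q, Z q⟫_ℝ) x (X x)
    + mvfderiv 𝓘(ℝ, E) (fun q => ⟪Z q, X q⟫_ℝ) x (Y x)
    - mvfderiv 𝓘(ℝ, E) (fun q => ⟪X q, Y q⟫_ℝ) x (Z x)
    + ⟪VectorField.mlieBracket 𝓘(ℝ, E) X Y x, Z x⟫_ℝ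
    - ⟪VectorField.mlieBracket 𝓘(ℝ, E) Y Z x, X x⟫_ℝ
    + ⟪VectorField.mlieBracket 𝓘(ℝ, E) Z X x, Y x⟫_ℝ)

set_option linter.unusedSectionVars false in
theorem mdiffAt_inner {Y Z : Π x : M, TangentSpace 𝓘(ℝ, E) x} {x : M}
    (hY : MDiffAt (T% Y) x) (hZ : MDiffAt (T% Z) x) : MDiffAt (fun q => ⟪Y q, Z q⟫_ℝ) x :=
  MDifferentiableAt.inner_bundle (IB := 𝓘(ℝ, E)) (F := E)
    (E := fun x : M => TangentSpace 𝓘(ℝ, E) x) hY hZ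

theorem koszul_tensorial_left {Y Z : Π x : M, TangentSpace 𝓘(ℝ, E) x} {x : M}
    (hY : MDiffAt (T% Y) x) (hZ : MDiffAt (T% Z) x) :
    TensorialAt 𝓘(ℝ, E) E (fun X => koszul X Y Z x) x where
  smul {f X} hf hX := by
    have h1 := mvfderiv_fun_mul hf (mdiffAt_inner hZ hX)
    have h2 := mvfderiv_fun_mul hf (mdiffAt_inner hX hY)
    have e1 : (fun q => ⟪Z q, (f • X) q⟫_ℝ) = fun q => f q * ⟪Z q, X q⟫_ℝ := by
      funext q; simp [inner_smul_right]
    have e2 : (fun q => ⟪(f • X) q, Y q⟫_ℝ) = fun q => f q * ⟪X q, Y q⟫_ℝ := by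
      funext q; simp [inner_smul_left]
    simp only [koszul, e1, e2, h1, h2, VectorField.mlieBracket_smul_left hf hX,
      VectorField.mlieBracket_smul_right hf hX]
    simp [inner_add_left, inner_smul_left, inner_smul_right, real_inner_comm]
    ring
  add {X X'} hX hX' := by
    have h1 := mvfderiv_fun_add (mdiffAt_inner hZ hX) (mdiffAt_inner hZ hX')
    have h2 := mvfderiv_fun_add (mdiffAt_inner hX hY) (mdiffAt_inner hX' hY)
    simp only [koszul, Pi.add_apply, inner_add_left, inner_add_right, h1, h2,
      VectorField.mlieBracket_add_left hX hX', VectorField.mlieBracket_add_right hX hX', map_add, add_apply]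
    simp
    ring

theorem koszul_tensorial_right {X Y : Π x : M, TangentSpace 𝓘(ℝ, E) x} {x : M}
    (hX : MDiffAt (T% X) x) (hY : MDiffAt (T% Y) x) :
    TensorialAt 𝓘(ℝ, E) E (fun Z => koszul X Y Z x) x where
  smul {f Z} hf hZ := by
    have h1 := mvfderiv_fun_mul hf (mdiffAt_inner hY hZ)
    have h2 := mvfderiv_fun_mul hf (mdiffAt_inner hZ hX)
    have e1 : (fun q => ⟪Y q, (f • Z) q⟫_ℝ) = fun q => f q * ⟪Y q, Z q⟫_ℝ := by
      funext q; simp [inner_smul_right]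
    have e2 : (fun q => ⟪(f • Z) q, X q⟫_ℝ) = fun q => f q * ⟪Z q, X q⟫_ℝ := by
      funext q; simp [inner_smul_left]
    simp only [koszul, e1, e2, h1, h2, VectorField.mlieBracket_smul_left hf hZ,
      VectorField.mlieBracket_smul_right hf hZ]
    simp [inner_add_left, inner_smul_left, inner_smul_right, real_inner_comm]
    ring
  add {Z Z'} hZ hZ' := by
    have h1 := mvfderiv_fun_add (mdiffAt_inner hY hZ) (mdiffAt_inner hY hZ')
    have h2 := mvfderiv_fun_add (mdiffAt_inner hZ hX) (mdiffAt_inner hZ' hX)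
    simp only [koszul, Pi.add_apply, inner_add_left, inner_add_right, h1, h2,
      VectorField.mlieBracket_add_left hZ hZ', VectorField.mlieBracket_add_right hZ hZ', map_add]
    simp
    ring

instance (x : M) : FiniteDimensional ℝ (TangentSpace 𝓘(ℝ, E) x) :=
  inferInstanceAs (FiniteDimensional ℝ E)

instance (x : M) : CompleteSpace (TangentSpace 𝓘(ℝ, E) x) :=
  FiniteDimensional.complete ℝ _

/-- The musical isomorphism `♯` at a point: `sharp φ` is the tangent vector representing the
covector `φ` through the metric. -/
def sharp (x : M) : (TangentSpace 𝓘(ℝ, E) x →L[ℝ] ℝ) →L[ℝ] TangentSpace 𝓘(ℝ, E) x :=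
  LinearMap.toContinuousLinearMap
    { toFun := fun φ => (InnerProductSpace.toDual ℝ (TangentSpace 𝓘(ℝ, E) x)).symm φ
      map_add' := fun φ ψ => map_add _ φ ψ
      map_smul' := fun c φ => by simp }

set_option linter.unusedSectionVars false in
theorem inner_sharp (x : M) (φ : TangentSpace 𝓘(ℝ, E) x →L[ℝ] ℝ) (u : TangentSpace 𝓘(ℝ, E) x) :
    ⟪sharp x φ, u⟫_ℝ = φ u := by
  simp [sharp]

open Classical in
/-- Underlying function of the Levi-Civita connection: at a point `x` at which `Y` is differentiable,
`leviCivitaFun Y x u` is the tangent vector `∇_u Y` determined by the Koszul formula. -/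
def leviCivitaFun (Y : Π x : M, TangentSpace 𝓘(ℝ, E) x) (x : M) :
    TangentSpace 𝓘(ℝ, E) x →L[ℝ] TangentSpace 𝓘(ℝ, E) x :=
  if hY : MDiffAt (T% Y) x then
    sharp x ∘L
      TensorialAt.mkHom₂ (F := E) (F' := E) (fun X Z => koszul X Y Z x) x
        (fun _ hZ => koszul_tensorial_left hY hZ)
        (fun _ hX => koszul_tensorial_right hX hY)
  else 0

theorem inner_leviCivitaFun {X Y Z : Π x : M, TangentSpace 𝓘(ℝ, E) x} {x : M}
    (hX : MDiffAt (T% X) x) (hY : MDiffAt (T% Y) x) (hZ : MDiffAt (T% Z) x) :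
    ⟪leviCivitaFun Y x (X x), Z x⟫_ℝ = koszul X Y Z x := by
  have := TensorialAt.mkHom₂_apply (F := E) (F' := E) (Φ := fun X Z => koszul X Y Z x)
    (fun _ hZ => koszul_tensorial_left hY hZ)
        (fun _ hX => koszul_tensorial_right hX hY) hX hZ
  rw [← this, leviCivitaFun, dif_pos hY]
  exact inner_sharp x _ _

theorem koszul_add_mid {X Y Y' Z : Π x : M, TangentSpace 𝓘(ℝ, E) x} {x : M}
    (hX : MDiffAt (T% X) x) (hY : MDiffAt (T% Y) x) (hY' : MDiffAt (T% Y') x)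
    (hZ : MDiffAt (T% Z) x) :
    koszul X (Y + Y') Z x = koszul X Y Z x + koszul X Y' Z x := by
  have h1 := mvfderiv_fun_add (mdiffAt_inner hY hZ) (mdiffAt_inner hY' hZ)
  have h2 := mvfderiv_fun_add (mdiffAt_inner hX hY) (mdiffAt_inner hX hY')
  simp only [koszul, Pi.add_apply, inner_add_left, inner_add_right, h1, h2,
    VectorField.mlieBracket_add_left hY hY', VectorField.mlieBracket_add_right hY hY', map_add]
  simp
  ring

theorem koszul_smul_mid {X Y Z : Π x : M, TangentSpace 𝓘(ℝ, E) x} {f : M → ℝ} {x : M}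
    (hX : MDiffAt (T% X) x) (hY : MDiffAt (T% Y) x) (hZ : MDiffAt (T% Z) x) (hf : MDiffAt f x) :
    koszul X (f • Y) Z x =
      f x * koszul X Y Z x + mvfderiv 𝓘(ℝ, E) f x (X x) * ⟪Y x, Z x⟫_ℝ := by
  have h1 := mvfderiv_fun_mul hf (mdiffAt_inner hY hZ)
  have h2 := mvfderiv_fun_mul hf (mdiffAt_inner hX hY)
  have e1 : (fun q => ⟪(f • Y) q, Z q⟫_ℝ) = fun q => f q * ⟪Y q, Z q⟫_ℝ := by
    funext q; simp [inner_smul_left]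
  have e2 : (fun q => ⟪X q, (f • Y) q⟫_ℝ) = fun q => f q * ⟪X q, Y q⟫_ℝ := by
    funext q; simp [inner_smul_right]
  simp only [koszul, e1, e2, h1, h2, VectorField.mlieBracket_smul_left hf hY,
    VectorField.mlieBracket_smul_right hf hY]
  simp [inner_add_left, inner_smul_left, inner_smul_right, real_inner_comm]
  ring

/-- The Levi-Civita connection of a Riemannian manifold; `leviCivita Y x (X x)` is `(∇_X Y)(x)`.
It is metric and torsion-free by the two theorems `leviCivita_metric`, `leviCivita_torsion`. -/
def leviCivita : CovariantDerivative 𝓘(ℝ, E) E (fun x : M => TangentSpace 𝓘(ℝ, E) x) where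
  toFun := leviCivitaFun
  isCovariantDerivativeOnUniv :=
    { add := fun {Y Y' x} hY hY' _ => by
        ext u
        refine ext_inner_right ℝ fun w => ?_
        have hu := FiberBundle.mdifferentiableAt_extend 𝓘(ℝ, E) E u
        have hw := FiberBundle.mdifferentiableAt_extend 𝓘(ℝ, E) E w
        have h1 := inner_leviCivitaFun hu hY hw
        have h2 := inner_leviCivitaFun hu hY' hw
        have h3 := inner_leviCivitaFun hu (mdifferentiableAt_add_section hY hY') hw
        rw [FiberBundle.extend_apply_self, FiberBundle.extend_apply_self] at h1 h2 h3
        rw [add_apply, inner_add_left, h1, h2, ← koszul_add_mid hu hY hY' hw]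
        exact h3
      leibniz := fun {Y f x} hY hf _ => by
        ext u
        refine ext_inner_right ℝ fun w => ?_
        have hu := FiberBundle.mdifferentiableAt_extend 𝓘(ℝ, E) E u
        have hw := FiberBundle.mdifferentiableAt_extend 𝓘(ℝ, E) E w
        have h1 := inner_leviCivitaFun hu hY hw
        have h3 := inner_leviCivitaFun hu (hf.smul_section hY) hw
        have h4 := koszul_smul_mid hu hY hw hf
        rw [FiberBundle.extend_apply_self, FiberBundle.extend_apply_self] at h1 h3 h4
        simp only [add_apply, inner_add_left, smul_apply, inner_smul_left]
        simp [inner_smul_left, h1]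
        exact h3.trans h4 }

theorem inner_leviCivita {X Y Z : Π x : M, TangentSpace 𝓘(ℝ, E) x} {x : M}
    (hX : MDiffAt (T% X) x) (hY : MDiffAt (T% Y) x) (hZ : MDiffAt (T% Z) x) :
    ⟪leviCivita Y x (X x), Z x⟫_ℝ = koszul X Y Z x :=
  inner_leviCivitaFun hX hY hZ

theorem leviCivita_metric {X Y Z : Π x : M, TangentSpace 𝓘(ℝ, E) x} {x : M}
    (hX : MDiffAt (T% X) x) (hY : MDiffAt (T% Y) x) (hZ : MDiffAt (T% Z) x) :
    mvfderiv 𝓘(ℝ, E) (fun q => ⟪Y q, Z q⟫_ℝ) x (X x)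
      = ⟪leviCivita Y x (X x), Z x⟫_ℝ + ⟪Y x, leviCivita Z x (X x)⟫_ℝ := by
  rw [real_inner_comm (leviCivita Z x (X x)), inner_leviCivita hX hY hZ, inner_leviCivita hX hZ hY,
    koszul, koszul]
  have e1 : (fun q => ⟪Z q, Y q⟫_ℝ) = fun q => ⟪Y q, Z q⟫_ℝ := by
    funext q; exact real_inner_comm _ _
  have e2 : (fun q => ⟪X q, Z q⟫_ℝ) = fun q => ⟪Z q, X q⟫_ℝ := by
    funext q; exact real_inner_comm _ _
  have e3 : (fun q => ⟪Y q, X q⟫_ℝ) = fun q => ⟪X q, Y q⟫_ℝ := by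
    funext q; exact real_inner_comm _ _
  rw [e1, e2, e3, VectorField.mlieBracket_swap_apply (V := X) (W := Z),
    VectorField.mlieBracket_swap_apply (V := Z) (W := Y),
    VectorField.mlieBracket_swap_apply (V := Y) (W := X)]
  simp only [inner_neg_left]
  ring

theorem leviCivita_torsion {X Y : Π x : M, TangentSpace 𝓘(ℝ, E) x} {x : M}
    (hX : MDiffAt (T% X) x) (hY : MDiffAt (T% Y) x) :
    leviCivita Y x (X x) - leviCivita X x (Y x) = VectorField.mlieBracket 𝓘(ℝ, E) X Y x := by
  refine ext_inner_right ℝ fun w => ?_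
  have hw := FiberBundle.mdifferentiableAt_extend 𝓘(ℝ, E) E w
  have h1 := inner_leviCivita hX hY hw
  have h2 := inner_leviCivita hY hX hw
  set W := FiberBundle.extend E w
  rw [← FiberBundle.extend_apply_self (F := E) w, inner_sub_left]
  rw [h1, h2, koszul, koszul]
  have e1 : (fun q => ⟪W q, Y q⟫_ℝ) = fun q => ⟪Y q, W q⟫_ℝ := by
    funext q; exact real_inner_comm _ _
  have e2 : (fun q => ⟪X q, W q⟫_ℝ) = fun q => ⟪W q, X q⟫_ℝ := by
    funext q; exact real_inner_comm _ _
  have e3 : (fun q => ⟪Y q, X q⟫_ℝ) = fun q => ⟪X q, Y q⟫_ℝ := by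
    funext q; exact real_inner_comm _ _
  rw [e1, e2, e3, VectorField.mlieBracket_swap_apply (V := X) (W := W),
    VectorField.mlieBracket_swap_apply (V := W) (W := Y),
    VectorField.mlieBracket_swap_apply (V := Y) (W := X)]
  simp only [inner_neg_left]
  ring

end LeviCivita

section Hermitian

variable {E : Type*} [NormedAddCommGroup E] [NormedSpace ℝ E] [FiniteDimensional ℝ E]
  {M : Type*} [TopologicalSpace M] [ChartedSpace E M] [IsManifold 𝓘(ℝ, E) ∞ M]
  [RiemannianBundle (fun x : M => TangentSpace 𝓘(ℝ, E) x)]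
  [IsContMDiffRiemannianBundle 𝓘(ℝ, E) ∞ E (fun x : M => TangentSpace 𝓘(ℝ, E) x)]

/-- `X` is a smooth vector field on `M`. -/
def IsSmoothField (X : Π x : M, TangentSpace 𝓘(ℝ, E) x) : Prop := CMDiff ∞ (T% X)

/-- The vector field `J X`, for a field `J` of endomorphisms of the tangent spaces. -/
def endoApply (J : Π x : M, TangentSpace 𝓘(ℝ, E) x →L[ℝ] TangentSpace 𝓘(ℝ, E) x)
    (X : Π x : M, TangentSpace 𝓘(ℝ, E) x) : Π x : M, TangentSpace 𝓘(ℝ, E) x :=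
  fun x => J x (X x)

/-- The Nijenhuis tensor `[JX, JY] - J[JX, Y] - J[X, JY] - [X, Y]`. -/
def nijenhuis (J : Π x : M, TangentSpace 𝓘(ℝ, E) x →L[ℝ] TangentSpace 𝓘(ℝ, E) x)
    (X Y : Π x : M, TangentSpace 𝓘(ℝ, E) x) (x : M) : TangentSpace 𝓘(ℝ, E) x :=
  VectorField.mlieBracket 𝓘(ℝ, E) (endoApply J X) (endoApply J Y) x
    - J x (VectorField.mlieBracket 𝓘(ℝ, E) (endoApply J X) Y x)
    - J x (VectorField.mlieBracket 𝓘(ℝ, E) X (endoApply J Y) x)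
    - VectorField.mlieBracket 𝓘(ℝ, E) X Y x

/-- `(M, J, g)` is a Hermitian manifold: `J` is a smooth almost complex structure, orthogonal for
the metric `g`, and integrable (its Nijenhuis tensor vanishes). -/
structure IsHermitian (J : Π x : M, TangentSpace 𝓘(ℝ, E) x →L[ℝ] TangentSpace 𝓘(ℝ, E) x) :
    Prop where
  smooth : ContMDiff 𝓘(ℝ, E) (𝓘(ℝ, E).prod 𝓘(ℝ, E →L[ℝ] E)) ∞
    (fun x => TotalSpace.mk' (E →L[ℝ] E) x (J x))
  sq : ∀ x u, J x (J x u) = -u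
  inner_map : ∀ x u v, ⟪J x u, J x v⟫_ℝ = ⟪u, v⟫_ℝ
  integrable : ∀ X Y, IsSmoothField X → IsSmoothField Y → ∀ x, nijenhuis J X Y x = 0

/-- The Kähler form `Ω(u, v) = g(u, J v)`. -/
def kahlerForm (J : Π x : M, TangentSpace 𝓘(ℝ, E) x →L[ℝ] TangentSpace 𝓘(ℝ, E) x)
    (x : M) (u v : TangentSpace 𝓘(ℝ, E) x) : ℝ := ⟪u, J x v⟫_ℝ

/-- The exterior derivative of a 1-form, evaluated on vector fields:
`dη(X, Y) = X η(Y) - Y η(X) - η([X, Y])`. -/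
def extDerivOne (η : Π x : M, TangentSpace 𝓘(ℝ, E) x →L[ℝ] ℝ)
    (X Y : Π x : M, TangentSpace 𝓘(ℝ, E) x) (x : M) : ℝ :=
  mvfderiv 𝓘(ℝ, E) (fun q => η q (Y q)) x (X x) - mvfderiv 𝓘(ℝ, E) (fun q => η q (X q)) x (Y x)
    - η x (VectorField.mlieBracket 𝓘(ℝ, E) X Y x)

/-- The exterior derivative of a 2-form, evaluated on vector fields: `dΩ(X, Y, Z)` is the cyclic sum
over `X, Y, Z` of `X Ω(Y, Z) - Ω([X, Y], Z)`. -/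
def extDerivTwo (Ω : Π x : M, TangentSpace 𝓘(ℝ, E) x → TangentSpace 𝓘(ℝ, E) x → ℝ)
    (X Y Z : Π x : M, TangentSpace 𝓘(ℝ, E) x) (x : M) : ℝ :=
  mvfderiv 𝓘(ℝ, E) (fun q => Ω q (Y q) (Z q)) x (X x)
    + mvfderiv 𝓘(ℝ, E) (fun q => Ω q (Z q) (X q)) x (Y x)
    + mvfderiv 𝓘(ℝ, E) (fun q => Ω q (X q) (Y q)) x (Z x)
    - Ω x (VectorField.mlieBracket 𝓘(ℝ, E) X Y x) (Z x)
    - Ω x (VectorField.mlieBracket 𝓘(ℝ, E) Y Z x) (X x)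
    - Ω x (VectorField.mlieBracket 𝓘(ℝ, E) Z X x) (Y x)

/-- The wedge product of a 1-form and a 2-form:
`(η ∧ Ω)(u, v, w) = η(u) Ω(v, w) + η(v) Ω(w, u) + η(w) Ω(u, v)`. -/
def wedgeOneTwo (η : Π x : M, TangentSpace 𝓘(ℝ, E) x →L[ℝ] ℝ)
    (Ω : Π x : M, TangentSpace 𝓘(ℝ, E) x → TangentSpace 𝓘(ℝ, E) x → ℝ)
    (x : M) (u v w : TangentSpace 𝓘(ℝ, E) x) : ℝ :=
  η x u * Ω x v w + η x v * Ω x w u + η x w * Ω x u v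

/-- `(M, J, g)` is a locally conformal Kähler manifold with Lee form `η`: it is a Hermitian
manifold, and `η` is a smooth closed 1-form with `dΩ = η ∧ Ω`. -/
structure IsLCKWithLeeForm (J : Π x : M, TangentSpace 𝓘(ℝ, E) x →L[ℝ] TangentSpace 𝓘(ℝ, E) x)
    (η : Π x : M, TangentSpace 𝓘(ℝ, E) x →L[ℝ] ℝ) : Prop where
  hermitian : IsHermitian J
  smooth : ContMDiff 𝓘(ℝ, E) (𝓘(ℝ, E).prod 𝓘(ℝ, E →L[ℝ] ℝ)) ∞
    (fun x => TotalSpace.mk' (E →L[ℝ] ℝ) x (η x))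
  closed : ∀ X Y, IsSmoothField X → IsSmoothField Y → ∀ x, extDerivOne η X Y x = 0
  lee : ∀ X Y Z, IsSmoothField X → IsSmoothField Y → IsSmoothField Z → ∀ x,
    extDerivTwo (kahlerForm J) X Y Z x = wedgeOneTwo η (kahlerForm J) x (X x) (Y x) (Z x)

/-- The Lee vector field `η♯`, that is `g(X, η♯) = η(X)` for all `X`. -/
def leeVector (η : Π x : M, TangentSpace 𝓘(ℝ, E) x →L[ℝ] ℝ) : Π x : M, TangentSpace 𝓘(ℝ, E) x :=
  fun x => sharp x (η x)

/-- A distribution `D` is integrable (involutive): the Lie bracket of any two smooth vector fields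
with values in `D` has values in `D`. -/
def IsIntegrable (D : Π x : M, Submodule ℝ (TangentSpace 𝓘(ℝ, E) x)) : Prop :=
  ∀ X Y : Π x : M, TangentSpace 𝓘(ℝ, E) x, IsSmoothField X → IsSmoothField Y →
    (∀ x, X x ∈ D x) → (∀ x, Y x ∈ D x) → ∀ x, VectorField.mlieBracket 𝓘(ℝ, E) X Y x ∈ D x

end Hermitian

section Submersion

variable {E : Type*} [NormedAddCommGroup E] [NormedSpace ℝ E] [FiniteDimensional ℝ E]
  {M : Type*} [TopologicalSpace M] [ChartedSpace E M] [IsManifold 𝓘(ℝ, E) ∞ M]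
  [RiemannianBundle (fun x : M => TangentSpace 𝓘(ℝ, E) x)]
  [IsContMDiffRiemannianBundle 𝓘(ℝ, E) ∞ E (fun x : M => TangentSpace 𝓘(ℝ, E) x)]
  {E' : Type*} [NormedAddCommGroup E'] [NormedSpace ℝ E'] [FiniteDimensional ℝ E']
  {N : Type*} [TopologicalSpace N] [ChartedSpace E' N] [IsManifold 𝓘(ℝ, E') ∞ N]
  [RiemannianBundle (fun x : N => TangentSpace 𝓘(ℝ, E') x)]
  [IsContMDiffRiemannianBundle 𝓘(ℝ, E') ∞ E' (fun x : N => TangentSpace 𝓘(ℝ, E') x)]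

variable (E E') in
/-- The differential `f_*` at `x`. -/
abbrev diff (f : M → N) (x : M) : TangentSpace 𝓘(ℝ, E) x →L[ℝ] TangentSpace 𝓘(ℝ, E') (f x) :=
  mfderiv 𝓘(ℝ, E) 𝓘(ℝ, E') f x

variable (E E') in
/-- The vertical distribution `ker f_*`. -/
def vert (f : M → N) (x : M) : Submodule ℝ (TangentSpace 𝓘(ℝ, E) x) :=
  LinearMap.ker (diff E E' f x).toLinearMap

variable (E E') in
/-- The horizontal distribution `(ker f_*)ᗮ`. -/
def horiz (f : M → N) (x : M) : Submodule ℝ (TangentSpace 𝓘(ℝ, E) x) := (vert E E' f x)ᗮ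

variable (E E') in
/-- The vertical part of a vector field (pointwise orthogonal projection to `ker f_*`). -/
def vProj (f : M → N) (X : Π x : M, TangentSpace 𝓘(ℝ, E) x) : Π x : M, TangentSpace 𝓘(ℝ, E) x :=
  fun x => (vert E E' f x).starProjection (X x)

variable (E E') in
/-- The horizontal part of a vector field (pointwise orthogonal projection to `(ker f_*)ᗮ`). -/
def hProj (f : M → N) (X : Π x : M, TangentSpace 𝓘(ℝ, E) x) : Π x : M, TangentSpace 𝓘(ℝ, E) x :=
  fun x => (horiz E E' f x).starProjection (X x)

variable (E E') in
/-- A Riemannian submersion: a smooth map onto `N`, of maximal rank, whose differential preserves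
the lengths of horizontal vectors. -/
structure IsRiemannianSubmersion (f : M → N) : Prop where
  smooth : ContMDiff 𝓘(ℝ, E) 𝓘(ℝ, E') ∞ f
  surjective : Function.Surjective f
  submersion : ∀ x, Function.Surjective (diff E E' f x)
  norm_map : ∀ x, ∀ u ∈ horiz E E' f x, ‖diff E E' f x u‖ = ‖u‖

variable (E E') in
/-- `f` is an anti-invariant Riemannian submersion: a Riemannian submersion with
`J (ker f_*) ⊆ (ker f_*)ᗮ`. -/
structure IsAntiInvariantSubmersion
    (J : Π x : M, TangentSpace 𝓘(ℝ, E) x →L[ℝ] TangentSpace 𝓘(ℝ, E) x) (f : M → N) : Prop where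
  riemannian : IsRiemannianSubmersion E E' f
  antiInvariant : ∀ x, ∀ u ∈ vert E E' f x, J x u ∈ horiz E E' f x

variable (E E') in
/-- The component `BX` in `JX = BX + CX`: the vertical part of `JX`. -/
def compB (J : Π x : M, TangentSpace 𝓘(ℝ, E) x →L[ℝ] TangentSpace 𝓘(ℝ, E) x) (f : M → N)
    (X : Π x : M, TangentSpace 𝓘(ℝ, E) x) : Π x : M, TangentSpace 𝓘(ℝ, E) x :=
  vProj E E' f (endoApply J X)

variable (E E') in
/-- The component `CX` in `JX = BX + CX`: the horizontal part of `JX`. (For an anti-invariant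
submersion and `X` horizontal it is automatically orthogonal to `J (ker f_*)`, because `X` is
orthogonal to `ker f_*` and `J` is orthogonal.) -/
def compC (J : Π x : M, TangentSpace 𝓘(ℝ, E) x →L[ℝ] TangentSpace 𝓘(ℝ, E) x) (f : M → N)
    (X : Π x : M, TangentSpace 𝓘(ℝ, E) x) : Π x : M, TangentSpace 𝓘(ℝ, E) x :=
  hProj E E' f (endoApply J X)

variable (E E') in
/-- O'Neill's tensor `A_X Y = 𝓗 ∇_{𝓗X} 𝓥Y + 𝓥 ∇_{𝓗X} 𝓗Y`. -/
def oneillA (f : M → N) (X Y : Π x : M, TangentSpace 𝓘(ℝ, E) x) :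
    Π x : M, TangentSpace 𝓘(ℝ, E) x :=
  hProj E E' f (fun x => leviCivita (vProj E E' f Y) x (hProj E E' f X x))
    + vProj E E' f (fun x => leviCivita (hProj E E' f Y) x (hProj E E' f X x))

/-- The pullback along `f : M → N` of the Levi-Civita connection of `N`, applied to a section `s` of
`f⁻¹(TN)` and a vector `u` at `x`. Writing `s = ∑ sⁱ (eᵢ ∘ f)` near `x` in a local frame `eᵢ` of
`TN` around `f x` (constant in the trivialization `t` there), this is
`∑ (dsⁱ(u) eᵢ + sⁱ(x) ∇_{f_* u} eᵢ)`; the field `FiberBundle.extend E' (s x)` is `∑ sⁱ(x) eᵢ`. -/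
def pullbackCov (f : M → N) (s : Π q : M, TangentSpace 𝓘(ℝ, E') (f q)) (x : M)
    (u : TangentSpace 𝓘(ℝ, E) x) : TangentSpace 𝓘(ℝ, E') (f x) :=
  let t := trivializationAt E' (TangentSpace 𝓘(ℝ, E') : N → Type _) (f x)
  t.symm (f x) (mvfderiv 𝓘(ℝ, E) (fun q => (t ⟨f q, s q⟩).2) x u)
    + leviCivita (FiberBundle.extend E' (s x)) (f x) (diff E E' f x u)

variable (E E') in
/-- The second fundamental form `(∇f_*)(X, Y) = ∇^f_X (f_* Y) - f_* (∇_X Y)` of a map `f`. -/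
def secondFundForm (f : M → N) (X Y : Π x : M, TangentSpace 𝓘(ℝ, E) x) (x : M) :
    TangentSpace 𝓘(ℝ, E') (f x) :=
  pullbackCov f (fun q => diff E E' f q (Y q)) x (X x) - diff E E' f x (leviCivita Y x (X x))

end Submersion

end RiemSubm

end

/-! A bracket of horizontal fields is horizontal exactly when it is orthogonal to every vertical
`V`, so everything rests on a formula for `g([X, Y], V)`, which by zero torsion is the
antisymmetrization of `g(∇_X Y, V)`.

Since `J` is orthogonal, `g(∇_X Y, V) = g(∇_X JY, JV) - g((∇_X J)Y, JV)`. Split `JY = BY + CY`. The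
`BY` part gives `g(A_X BY, JV)`. As `CY ⟂ JV`, the `CY` part is `-g(CY, ∇_X JV)`, that is `-g(CY, J
A_X V)` up to another `∇J` term. The two `∇J` terms come from the locally conformal Kähler identity
`inner_covDerivEndo`; because the Lee vector is vertical, only the `g(BY, B₁) g(X, JV)` term and
terms symmetric in `X, Y` survive, and the latter drop out of the bracket
(`inner_mlieBracket_horiz_vert`). Thus `g([X, Y], V)` is the right side of (c) minus its left side.

Between (b) and (c) only `(∇π_*)(X, BY) = -π_*(∇_X BY)` is needed, valid because `BY` is vertical;
the isometry of `π_*` on horizontal vectors turns it into `-g(A_X BY, JV)`.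

Smoothness of the projections is proved separately, since `BY`, `CY` and the vertical part of a
bracket are used as smooth fields. -/

set_option linter.unusedSectionVars false

noncomputable section

namespace RiemSubm

/-! ### Smooth local orthogonal frames -/

section Frames

variable {E : Type*} [NormedAddCommGroup E] [NormedSpace ℝ E] [FiniteDimensional ℝ E]
  {M : Type*} [TopologicalSpace M] [ChartedSpace E M] [IsManifold 𝓘(ℝ, E) ∞ M]
  [RiemannianBundle (fun x : M => TangentSpace 𝓘(ℝ, E) x)]
  [IsContMDiffRiemannianBundle 𝓘(ℝ, E) ∞ E (fun x : M => TangentSpace 𝓘(ℝ, E) x)]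

theorem contMDiffAt_inner {Y Z : Π x : M, TangentSpace 𝓘(ℝ, E) x} {x : M}
    (hY : CMDiffAt ∞ (T% Y) x) (hZ : CMDiffAt ∞ (T% Z) x) :
    CMDiffAt ∞ (fun q => ⟪Y q, Z q⟫_ℝ) x :=
  ContMDiffAt.inner_bundle (IB := 𝓘(ℝ, E)) (F := E)
    (E := fun x : M => TangentSpace 𝓘(ℝ, E) x) hY hZ

/-- Gram-Schmidt orthogonalization preserves smoothness of families of vector fields that are
linearly independent at the given point. -/
theorem contMDiffAt_gramSchmidt {n : ℕ} {s : Fin n → Π x : M, TangentSpace 𝓘(ℝ, E) x} {x : M}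
    (hs : ∀ i, CMDiffAt ∞ (T% (s i)) x) (hli : LinearIndependent ℝ fun i => s i x) (i : Fin n) :
    CMDiffAt ∞ (T% (fun q => InnerProductSpace.gramSchmidt ℝ (fun j => s j q) i)) x := by
  induction i using WellFoundedLT.induction with
  | ind i ih =>
    -- The recursion is written with inner products only, so that smoothness of the metric applies
    -- to the coefficients. No normalization is made, hence no square roots.
    have key : (fun q => InnerProductSpace.gramSchmidt ℝ (fun j => s j q) i)
        = s i - (fun q => ∑ j ∈ Finset.Iio i,
          (⟪InnerProductSpace.gramSchmidt ℝ (fun j => s j q) j, s i q⟫_ℝ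
            / ⟪InnerProductSpace.gramSchmidt ℝ (fun j => s j q) j,
              InnerProductSpace.gramSchmidt ℝ (fun j => s j q) j⟫_ℝ)
            • InnerProductSpace.gramSchmidt ℝ (fun j => s j q) j) := by
      funext q
      have h := InnerProductSpace.gramSchmidt_def'' ℝ (fun j => s j q) i
      simp only [Pi.sub_apply]
      rw [eq_sub_iff_add_eq]
      simp only [real_inner_self_eq_norm_sq]
      exact h.symm
    refine ContMDiffAt.congr_of_eventuallyEq ?_
      (.of_forall fun q => congrArg (TotalSpace.mk q) (congrFun key q))
    refine (hs i).sub_section (ContMDiffAt.sum_section fun j hj => ?_)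
    have hj' := ih j (Finset.mem_Iio.1 hj)
    refine ContMDiffAt.smul_section (ContMDiffAt.div₀ (contMDiffAt_inner hj' (hs i))
      (contMDiffAt_inner hj' hj') ?_) hj'
    rw [real_inner_self_eq_norm_sq]
    have := InnerProductSpace.gramSchmidt_ne_zero j hli
    positivity

/-- Gram-Schmidt applied to the frame of a trivialization. Smoothness and nonvanishing are recorded
only at `x₀`, which is enough to divide by `g(e i, e i)` there; the expansion holds in a
neighbourhood. -/
theorem exists_smooth_orthogonal_frame (x₀ : M) :
    ∃ e : Fin (Module.finrank ℝ E) → Π x : M, TangentSpace 𝓘(ℝ, E) x,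
      (∀ i, CMDiffAt ∞ (T% (e i)) x₀) ∧ (∀ i, e i x₀ ≠ 0) ∧
      ∀ᶠ x in nhds x₀, ∀ w : TangentSpace 𝓘(ℝ, E) x,
        w = ∑ i, (⟪e i x, w⟫_ℝ / ⟪e i x, e i x⟫_ℝ) • e i x := by
  set t := trivializationAt E (TangentSpace 𝓘(ℝ, E) : M → Type _) x₀
  set b := Module.finBasis ℝ E
  have hx₀ : x₀ ∈ t.baseSet := FiberBundle.mem_baseSet_trivializationAt' x₀
  have hli : ∀ x ∈ t.baseSet, LinearIndependent ℝ fun i => t.localFrame b i x := fun x hx =>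
    (t.isLocalFrameOn_localFrame_baseSet 𝓘(ℝ, E) 1 b).linearIndependent hx
  refine ⟨fun i q => InnerProductSpace.gramSchmidt ℝ (fun j => t.localFrame b j q) i,
    contMDiffAt_gramSchmidt (fun i => contMDiffAt_localFrame_of_mem ∞ t b i hx₀) (hli x₀ hx₀),
    fun i => InnerProductSpace.gramSchmidt_ne_zero i (hli x₀ hx₀), ?_⟩
  filter_upwards [t.open_baseSet.mem_nhds hx₀] with x hx w
  have hon := InnerProductSpace.gramSchmidtNormed_orthonormal (𝕜 := ℝ) (hli x hx)
  have hspan : ⊤ ≤ Submodule.span ℝ (Set.range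
      (InnerProductSpace.gramSchmidtNormed ℝ fun j => t.localFrame b j x)) := by
    rw [InnerProductSpace.span_gramSchmidtNormed_range, InnerProductSpace.span_gramSchmidt]
    exact (t.isLocalFrameOn_localFrame_baseSet 𝓘(ℝ, E) 1 b).generating hx
  have hw := (OrthonormalBasis.mk hon hspan).sum_repr' w
  refine hw.symm.trans (Finset.sum_congr rfl fun i _ => ?_)
  simp only [OrthonormalBasis.coe_mk, InnerProductSpace.gramSchmidtNormed, inner_smul_left,
    smul_smul, real_inner_self_eq_norm_sq]
  congr 1
  simp
  ring

end Frames

/-! ### Smoothness of the vertical and horizontal projections -/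

section Projections

variable {E : Type*} [NormedAddCommGroup E] [NormedSpace ℝ E] [FiniteDimensional ℝ E]
  {M : Type*} [TopologicalSpace M] [ChartedSpace E M] [IsManifold 𝓘(ℝ, E) ∞ M]
  [RiemannianBundle (fun x : M => TangentSpace 𝓘(ℝ, E) x)]
  [IsContMDiffRiemannianBundle 𝓘(ℝ, E) ∞ E (fun x : M => TangentSpace 𝓘(ℝ, E) x)]
  {E' : Type*} [NormedAddCommGroup E'] [NormedSpace ℝ E'] [FiniteDimensional ℝ E']
  {N : Type*} [TopologicalSpace N] [ChartedSpace E' N] [IsManifold 𝓘(ℝ, E') ∞ N]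
  [RiemannianBundle (fun x : N => TangentSpace 𝓘(ℝ, E') x)]
  [IsContMDiffRiemannianBundle 𝓘(ℝ, E') ∞ E' (fun x : N => TangentSpace 𝓘(ℝ, E') x)]
  {f : M → N}

theorem starProjection_vert_add_horiz (f : M → N) (x : M) (u : TangentSpace 𝓘(ℝ, E) x) :
    (vert E E' f x).starProjection u + (horiz E E' f x).starProjection u = u :=
  Submodule.starProjection_add_starProjection_orthogonal u

theorem inner_diff (hf : IsRiemannianSubmersion E E' f) {x : M} {u v : TangentSpace 𝓘(ℝ, E) x}
    (hu : u ∈ horiz E E' f x) (hv : v ∈ horiz E E' f x) :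
    ⟪diff E E' f x u, diff E E' f x v⟫_ℝ = ⟪u, v⟫_ℝ := by
  rw [real_inner_eq_norm_add_mul_self_sub_norm_mul_self_sub_norm_mul_self_div_two,
    real_inner_eq_norm_add_mul_self_sub_norm_mul_self_sub_norm_mul_self_div_two, ← map_add,
    hf.norm_map x _ hu, hf.norm_map x _ hv, hf.norm_map x _ (add_mem hu hv)]

theorem diff_starProjection_horiz (f : M → N) (x : M) (u : TangentSpace 𝓘(ℝ, E) x) :
    diff E E' f x ((horiz E E' f x).starProjection u) = diff E E' f x u := by
  have h : diff E E' f x ((vert E E' f x).starProjection u) = 0 :=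
    (vert E E' f x).starProjection_apply_mem u
  conv_rhs => rw [← starProjection_vert_add_horiz (E' := E') f x u, map_add, h, zero_add]

/-- One horizontal argument suffices: the vertical part of `u` is killed by the differential and is
orthogonal to `v`. -/
theorem inner_diff_right (hf : IsRiemannianSubmersion E E' f) {x : M}
    (u : TangentSpace 𝓘(ℝ, E) x) {v : TangentSpace 𝓘(ℝ, E) x} (hv : v ∈ horiz E E' f x) :
    ⟪diff E E' f x u, diff E E' f x v⟫_ℝ = ⟪u, v⟫_ℝ := by
  have h : ⟪(vert E E' f x).starProjection u, v⟫_ℝ = 0 :=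
    hv _ ((vert E E' f x).starProjection_apply_mem u)
  rw [← diff_starProjection_horiz f x u,
    inner_diff hf ((horiz E E' f x).starProjection_apply_mem u) hv]
  conv_rhs => rw [← starProjection_vert_add_horiz (E' := E') f x u, inner_add_left, h, zero_add]

theorem contMDiffAt_diff_apply (hf : ContMDiff 𝓘(ℝ, E) 𝓘(ℝ, E') ∞ f)
    {X : Π x : M, TangentSpace 𝓘(ℝ, E) x} {x : M} (hX : CMDiffAt ∞ (T% X) x) :
    ContMDiffAt 𝓘(ℝ, E) (𝓘(ℝ, E').prod 𝓘(ℝ, E')) ∞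
      (fun q => (⟨f q, diff E E' f q (X q)⟩ : TangentBundle 𝓘(ℝ, E') N)) x := by
  have h := hf.contMDiff_tangentMap (m := ∞) le_rfl
  exact (h (⟨x, X x⟩ : TangentBundle 𝓘(ℝ, E) M)).comp x hX

/-- In an orthogonal frame the coefficients of the horizontal part involve `g(e i, 𝓗X) = g_N(f_* (e
i), f_* X)`, which is smooth because `f_*` and both metrics are. -/
theorem isSmoothField_hProj (hf : IsRiemannianSubmersion E E' f)
    {X : Π x : M, TangentSpace 𝓘(ℝ, E) x} (hX : IsSmoothField X) :
    IsSmoothField (hProj E E' f X) := by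
  intro x₀
  obtain ⟨e, he, he0, hsum⟩ := exists_smooth_orthogonal_frame (E := E) x₀
  have h1 : CMDiffAt ∞ (T% (fun q => ∑ i,
      (⟪diff E E' f q (e i q), diff E E' f q (X q)⟫_ℝ / ⟪e i q, e i q⟫_ℝ) • e i q)) x₀ := by
    refine ContMDiffAt.sum_section fun i _ => ContMDiffAt.smul_section
      (ContMDiffAt.div₀ ?_ (contMDiffAt_inner (he i) (he i)) ?_) (he i)
    · exact ContMDiffAt.inner_bundle (IB := 𝓘(ℝ, E')) (F := E')
        (E := fun y : N => TangentSpace 𝓘(ℝ, E') y) (b := f)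
        (contMDiffAt_diff_apply hf.smooth (he i)) (contMDiffAt_diff_apply hf.smooth (hX x₀))
    · rw [real_inner_self_eq_norm_sq]
      have := he0 i
      positivity
  refine h1.congr_of_eventuallyEq ?_
  filter_upwards [hsum] with q hq
  refine congrArg (TotalSpace.mk q) ((hq _).trans (Finset.sum_congr rfl fun i _ => ?_))
  rw [← diff_starProjection_horiz f q (X q),
    inner_diff_right hf _ ((horiz E E' f q).starProjection_apply_mem _)]
  rfl

theorem vProj_eq_sub_hProj (f : M → N) (X : Π x : M, TangentSpace 𝓘(ℝ, E) x) :
    vProj E E' f X = X - hProj E E' f X := by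
  funext x
  exact eq_sub_of_add_eq (starProjection_vert_add_horiz f x (X x))

theorem isSmoothField_vProj (hf : IsRiemannianSubmersion E E' f)
    {X : Π x : M, TangentSpace 𝓘(ℝ, E) x} (hX : IsSmoothField X) :
    IsSmoothField (vProj E E' f X) := by
  rw [vProj_eq_sub_hProj]
  exact ContMDiff.sub_section hX (isSmoothField_hProj hf hX)

end Projections

/-! ### The covariant derivative of `J` on Hermitian and locally conformal Kähler manifolds -/

section CovariantDerivativeOfEndomorphism

variable {E : Type*} [NormedAddCommGroup E] [NormedSpace ℝ E] [FiniteDimensional ℝ E]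
  {M : Type*} [TopologicalSpace M] [ChartedSpace E M] [IsManifold 𝓘(ℝ, E) ∞ M]
  [RiemannianBundle (fun x : M => TangentSpace 𝓘(ℝ, E) x)]
  [IsContMDiffRiemannianBundle 𝓘(ℝ, E) ∞ E (fun x : M => TangentSpace 𝓘(ℝ, E) x)]
  {J : Π x : M, TangentSpace 𝓘(ℝ, E) x →L[ℝ] TangentSpace 𝓘(ℝ, E) x}
  {η : Π x : M, TangentSpace 𝓘(ℝ, E) x →L[ℝ] ℝ}
  {X Y Z : Π x : M, TangentSpace 𝓘(ℝ, E) x}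

theorem IsSmoothField.mdifferentiableAt (hX : IsSmoothField X) (x : M) : MDiffAt (T% X) x :=
  (hX x).mdifferentiableAt (by simp)

theorem isSmoothField_mlieBracket (hX : IsSmoothField X) (hY : IsSmoothField Y) :
    IsSmoothField (VectorField.mlieBracket 𝓘(ℝ, E) X Y) := by
  intro x
  -- Over `ℝ`, `minSmoothness` is the exponent itself, and `∞ + 1 = ∞`, so the bracket loses no
  -- regularity.
  have : IsManifold 𝓘(ℝ, E) (minSmoothness ℝ 2) M := by
    rw [minSmoothness_of_isRCLikeNormedField]; infer_instance
  have : IsManifold 𝓘(ℝ, E) (((⊤ : ℕ∞) : ℕ∞ω) + 1) M := by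
    rwa [show (((⊤ : ℕ∞) : ℕ∞ω) + 1) = ∞ from rfl]
  exact ContMDiffAt.mlieBracket_vectorField (m := ⊤) (n := ⊤) (hX x) (hY x)
    (by simp [minSmoothness_of_isRCLikeNormedField])

theorem IsHermitian.isSmoothField_endoApply (hJ : IsHermitian J) (hX : IsSmoothField X) :
    IsSmoothField (endoApply J X) := by
  intro x
  exact ContMDiffAt.clm_bundle_apply (F₁ := E) (F₂ := E)
    (E₁ := fun x : M => TangentSpace 𝓘(ℝ, E) x) (E₂ := fun x : M => TangentSpace 𝓘(ℝ, E) x)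
    (b := fun x => x) (ϕ := J) (v := X) (hJ.smooth x) (hX x)

theorem IsHermitian.inner_map_left (hJ : IsHermitian J) (x : M) (u v : TangentSpace 𝓘(ℝ, E) x) :
    ⟪J x u, v⟫_ℝ = -⟪u, J x v⟫_ℝ := by
  have h := hJ.inner_map x u (J x v)
  rw [hJ.sq, inner_neg_right] at h
  linarith

theorem leviCivita_neg (hY : IsSmoothField Y) (x : M) (u : TangentSpace 𝓘(ℝ, E) x) :
    leviCivita (-Y) x u = -leviCivita Y x u := by
  have h := (leviCivita (E := E) (M := M)).isCovariantDerivativeOnUniv.smul_const (-1)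
    (hY.mdifferentiableAt x) (Set.mem_univ x)
  have h' := congrArg (fun φ => φ u) h
  simpa using h'

/-- The covariant derivative `(∇_X J) Y = ∇_X (J Y) - J ∇_X Y` of a field of endomorphisms. -/
def covDerivEndo (J : Π x : M, TangentSpace 𝓘(ℝ, E) x →L[ℝ] TangentSpace 𝓘(ℝ, E) x)
    (X Y : Π x : M, TangentSpace 𝓘(ℝ, E) x) (x : M) : TangentSpace 𝓘(ℝ, E) x :=
  leviCivita (endoApply J Y) x (X x) - J x (leviCivita Y x (X x))

/-- Differentiate `g(JY, Z) = -g(Y, JZ)` with the metric connection. -/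
theorem IsHermitian.covDerivEndo_skew (hJ : IsHermitian J) (hX : IsSmoothField X)
    (hY : IsSmoothField Y) (hZ : IsSmoothField Z) (x : M) :
    ⟪covDerivEndo J X Y x, Z x⟫_ℝ = -⟪covDerivEndo J X Z x, Y x⟫_ℝ := by
  have hX' := hX.mdifferentiableAt x
  have h1 := leviCivita_metric hX' ((hJ.isSmoothField_endoApply hY).mdifferentiableAt x)
    (hZ.mdifferentiableAt x)
  have h2 := leviCivita_metric hX' (hY.mdifferentiableAt x)
    ((hJ.isSmoothField_endoApply hZ).mdifferentiableAt x)
  have e : (fun q => ⟪endoApply J Y q, Z q⟫_ℝ) = fun q => -⟪Y q, endoApply J Z q⟫_ℝ := by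
    funext q; exact hJ.inner_map_left q _ _
  have h3 : mvfderiv 𝓘(ℝ, E) (fun q => -⟪Y q, endoApply J Z q⟫_ℝ) x (X x)
      = -mvfderiv 𝓘(ℝ, E) (fun q => ⟪Y q, endoApply J Z q⟫_ℝ) x (X x) := by
    have := mvfderiv_fun_neg (I := 𝓘(ℝ, E)) (g := fun q => ⟪Y q, endoApply J Z q⟫_ℝ) (x := x)
    rw [this]; rfl
  rw [e, h3, h2] at h1
  simp only [covDerivEndo, inner_sub_left, hJ.inner_map_left]
  simp only [endoApply, hJ.inner_map_left] at h1 ⊢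
  rw [real_inner_comm (leviCivita (endoApply J Z) x (X x)) (Y x),
    real_inner_comm (J x (leviCivita Z x (X x))) (Y x)] at h1
  rw [hJ.inner_map_left] at h1
  linarith

/-- Differentiating `J² = -1` shows that `∇_X J` anticommutes with `J`. -/
theorem IsHermitian.covDerivEndo_map (hJ : IsHermitian J) (hY : IsSmoothField Y) (x : M) :
    covDerivEndo J X (endoApply J Y) x = -J x (covDerivEndo J X Y x) := by
  have e : endoApply J (endoApply J Y) = -Y := by
    funext q; exact hJ.sq q _
  rw [covDerivEndo, e, leviCivita_neg hY, covDerivEndo, map_sub, hJ.sq]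
  abel

/-- With zero torsion, `dΩ` is the cyclic sum of `(∇_X Ω)(Y, Z) = g(Y, (∇_X J)Z)`; the minus sign
comes from skewness of `∇_X J`. -/
theorem IsHermitian.extDerivTwo_kahlerForm (hJ : IsHermitian J) (hX : IsSmoothField X)
    (hY : IsSmoothField Y) (hZ : IsSmoothField Z) (x : M) :
    extDerivTwo (kahlerForm J) X Y Z x
      = -(⟪covDerivEndo J X Y x, Z x⟫_ℝ + ⟪covDerivEndo J Y Z x, X x⟫_ℝ
        + ⟪covDerivEndo J Z X x, Y x⟫_ℝ) := by
  have dX := hX.mdifferentiableAt x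
  have dY := hY.mdifferentiableAt x
  have dZ := hZ.mdifferentiableAt x
  have h1 := leviCivita_metric dX dY ((hJ.isSmoothField_endoApply hZ).mdifferentiableAt x)
  have h2 := leviCivita_metric dY dZ ((hJ.isSmoothField_endoApply hX).mdifferentiableAt x)
  have h3 := leviCivita_metric dZ dX ((hJ.isSmoothField_endoApply hY).mdifferentiableAt x)
  have s1 := hJ.covDerivEndo_skew hX hY hZ x
  have s2 := hJ.covDerivEndo_skew hY hZ hX x
  have s3 := hJ.covDerivEndo_skew hZ hX hY x
  simp only [covDerivEndo, inner_sub_left, hJ.inner_map_left] at s1 s2 s3 ⊢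
  simp only [endoApply] at h1 h2 h3 s1 s2 s3 ⊢
  simp only [extDerivTwo, kahlerForm, h1, h2, h3, ← leviCivita_torsion dX dY,
    ← leviCivita_torsion dY dZ, ← leviCivita_torsion dZ dX, inner_sub_left,
    real_inner_comm (leviCivita (endoApply J Z) x (X x)) (Y x),
    real_inner_comm (leviCivita (endoApply J X) x (Y x)) (Z x),
    real_inner_comm (leviCivita (endoApply J Y) x (Z x)) (X x)]
  linarith

/-- Write each bracket as a difference of covariant derivatives; the terms in which `J` is not
differentiated cancel. -/
theorem IsHermitian.nijenhuis_eq (hJ : IsHermitian J) (hX : IsSmoothField X)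
    (hY : IsSmoothField Y) (x : M) :
    nijenhuis J X Y x = covDerivEndo J (endoApply J X) Y x - covDerivEndo J (endoApply J Y) X x
        + J x (covDerivEndo J Y X x) - J x (covDerivEndo J X Y x) := by
  have dX := hX.mdifferentiableAt x
  have dY := hY.mdifferentiableAt x
  have dJX := (hJ.isSmoothField_endoApply hX).mdifferentiableAt x
  have dJY := (hJ.isSmoothField_endoApply hY).mdifferentiableAt x
  simp only [nijenhuis, covDerivEndo, ← leviCivita_torsion dX dY, ← leviCivita_torsion dJX dY,
    ← leviCivita_torsion dX dJY, ← leviCivita_torsion dJX dJY, map_sub, hJ.sq]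
  abel

/-- On a locally conformal Kähler manifold,
`(∇_X J) Y = ½ (η(JY) X - η(Y) JX - g(X, JY) η♯ + g(X, Y) J η♯)`, paired with `Z`. -/
theorem IsLCKWithLeeForm.inner_covDerivEndo (hJ : IsLCKWithLeeForm J η) (hX : IsSmoothField X)
    (hY : IsSmoothField Y) (hZ : IsSmoothField Z) (x : M) :
    2 * ⟪covDerivEndo J X Y x, Z x⟫_ℝ
      = η x (J x (Y x)) * ⟪X x, Z x⟫_ℝ + η x (Y x) * ⟪X x, J x (Z x)⟫_ℝ
        - η x (J x (Z x)) * ⟪X x, Y x⟫_ℝ - η x (Z x) * ⟪X x, J x (Y x)⟫_ℝ := by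
  have H := hJ.hermitian
  have hJX := H.isSmoothField_endoApply hX
  have hJY := H.isSmoothField_endoApply hY
  have hJZ := H.isSmoothField_endoApply hZ
  have l1 := hJ.lee X Y Z hX hY hZ x
  have l2 := hJ.lee X _ _ hX hJY hJZ x
  rw [H.extDerivTwo_kahlerForm hX hY hZ] at l1
  rw [H.extDerivTwo_kahlerForm hX hJY hJZ] at l2
  -- The identity behind the computation is `2 g((∇_X J)Y, Z) = dΩ(X, JY, JZ) - dΩ(X, Y, Z) + g(N(Y,
  -- Z), JX)`, here with `N = 0`. The `η(X)` terms of the two wedge products cancel because `Ω` is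
  -- `J`-invariant.
  have n := congrArg (fun w => ⟪w, J x (X x)⟫_ℝ) (H.integrable Y Z hY hZ x)
  simp only [H.nijenhuis_eq hY hZ, inner_add_left, inner_sub_left, H.inner_map,
    inner_zero_left] at n
  have s1 := H.covDerivEndo_skew hZ hX hY x
  have s2 := H.covDerivEndo_skew hJZ hX hJY x
  rw [H.covDerivEndo_map hY, H.covDerivEndo_map hZ] at *
  have s3 := H.covDerivEndo_skew hX hY hZ x
  simp only [wedgeOneTwo, kahlerForm, endoApply, H.sq, inner_neg_left, inner_neg_right,
    H.inner_map_left, neg_neg] at l1 l2 n s1 s2 s3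
  simp only [map_neg, inner_neg_right, neg_neg, real_inner_comm (X x) (Z x)] at l2
  have e : ⟪Z x, J x (X x)⟫_ℝ = -⟪X x, J x (Z x)⟫_ℝ := by
    rw [real_inner_comm, H.inner_map_left]
  rw [e] at l1
  linarith

end CovariantDerivativeOfEndomorphism

/-! ### O'Neill's tensor and the second fundamental form on vertical fields -/

section Submersion

variable {E : Type*} [NormedAddCommGroup E] [NormedSpace ℝ E] [FiniteDimensional ℝ E]
  {M : Type*} [TopologicalSpace M] [ChartedSpace E M] [IsManifold 𝓘(ℝ, E) ∞ M]
  [RiemannianBundle (fun x : M => TangentSpace 𝓘(ℝ, E) x)]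
  [IsContMDiffRiemannianBundle 𝓘(ℝ, E) ∞ E (fun x : M => TangentSpace 𝓘(ℝ, E) x)]
  {E' : Type*} [NormedAddCommGroup E'] [NormedSpace ℝ E'] [FiniteDimensional ℝ E']
  {N : Type*} [TopologicalSpace N] [ChartedSpace E' N] [IsManifold 𝓘(ℝ, E') ∞ N]
  [RiemannianBundle (fun x : N => TangentSpace 𝓘(ℝ, E') x)]
  [IsContMDiffRiemannianBundle 𝓘(ℝ, E') ∞ E' (fun x : N => TangentSpace 𝓘(ℝ, E') x)]
  {J : Π x : M, TangentSpace 𝓘(ℝ, E) x →L[ℝ] TangentSpace 𝓘(ℝ, E) x}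
  {η : Π x : M, TangentSpace 𝓘(ℝ, E) x →L[ℝ] ℝ} {f : M → N}
  {X Y V W : Π x : M, TangentSpace 𝓘(ℝ, E) x}

theorem vProj_mem (f : M → N) (X : Π x : M, TangentSpace 𝓘(ℝ, E) x) (x : M) :
    vProj E E' f X x ∈ vert E E' f x :=
  (vert E E' f x).starProjection_apply_mem _

theorem hProj_mem (f : M → N) (X : Π x : M, TangentSpace 𝓘(ℝ, E) x) (x : M) :
    hProj E E' f X x ∈ horiz E E' f x :=
  (horiz E E' f x).starProjection_apply_mem _

theorem inner_vert_horiz {x : M} {u v : TangentSpace 𝓘(ℝ, E) x} (hu : u ∈ vert E E' f x)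
    (hv : v ∈ horiz E E' f x) : ⟪u, v⟫_ℝ = 0 :=
  hv u hu

theorem inner_horiz_vert {x : M} {u v : TangentSpace 𝓘(ℝ, E) x} (hu : u ∈ horiz E E' f x)
    (hv : v ∈ vert E E' f x) : ⟪u, v⟫_ℝ = 0 := by
  rw [real_inner_comm]; exact hu v hv

theorem inner_hProj_left (f : M → N) (W : Π x : M, TangentSpace 𝓘(ℝ, E) x) {x : M}
    {v : TangentSpace 𝓘(ℝ, E) x} (hv : v ∈ horiz E E' f x) :
    ⟪hProj E E' f W x, v⟫_ℝ = ⟪W x, v⟫_ℝ := by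
  conv_rhs => rw [← starProjection_vert_add_horiz (E' := E') f x (W x), inner_add_left,
    inner_vert_horiz ((vert E E' f x).starProjection_apply_mem _) hv, zero_add]
  rfl

theorem inner_vProj_left (f : M → N) (W : Π x : M, TangentSpace 𝓘(ℝ, E) x) {x : M}
    {v : TangentSpace 𝓘(ℝ, E) x} (hv : v ∈ vert E E' f x) :
    ⟪vProj E E' f W x, v⟫_ℝ = ⟪W x, v⟫_ℝ := by
  conv_rhs => rw [← starProjection_vert_add_horiz (E' := E') f x (W x), inner_add_left,
    inner_horiz_vert ((horiz E E' f x).starProjection_apply_mem _) hv, add_zero]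
  rfl

theorem hProj_eq_self (hX : ∀ x, X x ∈ horiz E E' f x) : hProj E E' f X = X :=
  funext fun x => Submodule.starProjection_eq_self_iff.2 (hX x)

theorem vProj_eq_self (hV : ∀ x, V x ∈ vert E E' f x) : vProj E E' f V = V :=
  funext fun x => Submodule.starProjection_eq_self_iff.2 (hV x)

theorem hProj_eq_zero (hV : ∀ x, V x ∈ vert E E' f x) : hProj E E' f V = 0 := by
  have h := vProj_eq_sub_hProj (E' := E') f V
  rw [vProj_eq_self hV] at h
  exact sub_eq_self.1 h.symm

/-- For `X` horizontal and `W` vertical, O'Neill's tensor `A_X W` is the horizontal part of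
`∇_X W`. -/
theorem oneillA_of_vert (hX : ∀ x, X x ∈ horiz E E' f x) (hW : ∀ x, W x ∈ vert E E' f x) :
    oneillA E E' f X W = hProj E E' f (fun x => leviCivita W x (X x)) := by
  -- The second summand of `A_X W` differentiates the horizontal part of `W`, which is the zero
  -- field.
  have hz : vProj E E' f (fun x => leviCivita (0 : Π x : M, TangentSpace 𝓘(ℝ, E) x) x (X x))
      = 0 := by
    funext x
    simp only [vProj, CovariantDerivative.zero]
    simp
  rw [oneillA, hProj_eq_self hX, vProj_eq_self hW, hProj_eq_zero hW, hz, add_zero]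

/-- Both summands of the pullback connection vanish by locality: near `x` the zero section has zero
coordinates in the trivialization, and the extension of the zero vector vanishes near `f x`. -/
theorem pullbackCov_zero (hf : Continuous f) (x : M) (u : TangentSpace 𝓘(ℝ, E) x) :
    pullbackCov f (fun q => (0 : TangentSpace 𝓘(ℝ, E') (f q))) x u = 0 := by
  set t := trivializationAt E' (TangentSpace 𝓘(ℝ, E') : N → Type _) (f x)
  have ht : f x ∈ t.baseSet := FiberBundle.mem_baseSet_trivializationAt' (f x)
  have h0 : ∀ y ∈ t.baseSet, (t ⟨y, (0 : TangentSpace 𝓘(ℝ, E') y)⟩).2 = 0 := fun y hy =>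
    (t.linear ℝ hy).map_zero
  have hs : ∀ y ∈ t.baseSet, t.symm y 0 = 0 := fun y hy => by
    rw [← Trivialization.symmₗ_apply (R := ℝ) t hy, map_zero]
  have h1 : (fun q => (t ⟨f q, (0 : TangentSpace 𝓘(ℝ, E') (f q))⟩).2) =ᶠ[nhds x]
      fun _ => (0 : E') := by
    filter_upwards [hf.continuousAt.preimage_mem_nhds (t.open_baseSet.mem_nhds ht)] with q hq
    exact h0 _ hq
  have h2 : mvfderiv 𝓘(ℝ, E) (fun q => (t ⟨f q, (0 : TangentSpace 𝓘(ℝ, E') (f q))⟩).2) x u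
      = 0 := by
    have : mvfderiv 𝓘(ℝ, E) (fun q => (t ⟨f q, (0 : TangentSpace 𝓘(ℝ, E') (f q))⟩).2) x
        = mvfderiv 𝓘(ℝ, E) (fun _ => (0 : E')) x := by
      ext w
      simp only [mvfderiv, h1.mfderiv_eq]
      rfl
    rw [this, mvfderiv_const]
    rfl
  set e : Π y : N, TangentSpace 𝓘(ℝ, E') y :=
    FiberBundle.extend E' (0 : TangentSpace 𝓘(ℝ, E') (f x)) with he
  have h3 : ∀ᶠ y in nhds (f x), e y = (0 : Π y : N, TangentSpace 𝓘(ℝ, E') y) y := by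
    filter_upwards [t.open_baseSet.mem_nhds ht] with y hy
    change t.symm y (t ⟨f x, 0⟩).2 = 0
    rw [h0 _ ht, hs y hy]
  have h4 : leviCivita e (f x) = 0 := by
    rw [(leviCivita (E := E') (M := N)).isCovariantDerivativeOnUniv.congr_of_eventuallyEq
      (FiberBundle.mdifferentiableAt_extend 𝓘(ℝ, E') E' _) (mdifferentiableAt_zeroSection ..)
      Filter.univ_mem h3]
    exact congrFun (CovariantDerivative.zero _) _
  simp only [pullbackCov, ← he, h4]
  rw [h2, hs _ ht]
  simp

/-- On a vertical field, the second fundamental form of a submersion is `-f_* ∇`. -/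
theorem secondFundForm_of_vert (hf : Continuous f) (hW : ∀ x, W x ∈ vert E E' f x) (x : M) :
    secondFundForm E E' f X W x = -diff E E' f x (leviCivita W x (X x)) := by
  have h : (fun q => diff E E' f q (W q)) = fun q => 0 := funext fun q => hW q
  rw [secondFundForm, h, pullbackCov_zero hf, zero_sub]

/-- `BY` is vertical and `JV` is horizontal, so both sides reduce to `-g(∇_X BY, JV)`. This is the
passage between (b) and (c). -/
theorem inner_secondFundForm_compB (hf : IsAntiInvariantSubmersion E E' J f)
    (hX : ∀ x, X x ∈ horiz E E' f x) (hV : ∀ x, V x ∈ vert E E' f x) (x : M) :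
    ⟪secondFundForm E E' f X (compB E E' J f Y) x, diff E E' f x (J x (V x))⟫_ℝ
      = -⟪oneillA E E' f X (compB E E' J f Y) x, J x (V x)⟫_ℝ := by
  have hB : ∀ x, compB E E' J f Y x ∈ vert E E' f x := vProj_mem f _
  have hJV := hf.antiInvariant x _ (hV x)
  rw [secondFundForm_of_vert hf.riemannian.smooth.continuous hB, inner_neg_left,
    inner_diff_right hf.riemannian _ hJV, oneillA_of_vert hX hB, inner_hProj_left f _ hJV]

/-! ### The decomposition `JY = BY + CY` -/

theorem compC_eq_sub_compB : compC E E' J f Y = endoApply J Y - compB E E' J f Y := by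
  rw [compB, vProj_eq_sub_hProj, sub_sub_cancel]; rfl

theorem compB_add_compC : compB E E' J f Y + compC E E' J f Y = endoApply J Y := by
  rw [compC_eq_sub_compB, add_sub_cancel]

/-- `JY ⟂ Jv` because `Y ⟂ v`, and `BY ⟂ Jv` because `Jv` is horizontal. -/
theorem inner_compC_map_vert (hJ : IsHermitian J) (hf : IsAntiInvariantSubmersion E E' J f)
    (hY : ∀ x, Y x ∈ horiz E E' f x) {x : M} {v : TangentSpace 𝓘(ℝ, E) x}
    (hv : v ∈ vert E E' f x) : ⟪compC E E' J f Y x, J x v⟫_ℝ = 0 := by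
  have h1 : ⟪endoApply J Y x, J x v⟫_ℝ = 0 := by
    rw [endoApply, hJ.inner_map, inner_horiz_vert (hY x) hv]
  have h2 : ⟪compB E E' J f Y x, J x v⟫_ℝ = 0 :=
    inner_vert_horiz (vProj_mem f _ x) (hf.antiInvariant x v hv)
  rw [compC_eq_sub_compB, Pi.sub_apply, inner_sub_left, h1, h2, sub_zero]

/-! ### The vertical Lee vector and the vertical part of brackets -/

theorem inner_leeVector (x : M) (u : TangentSpace 𝓘(ℝ, E) x) : ⟪u, leeVector η x⟫_ℝ = η x u := by
  rw [real_inner_comm]; exact inner_sharp x _ u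

theorem IsLCKWithLeeForm.lee_eq_zero_of_horiz
    (hLee : ∀ x, leeVector η x ∈ vert E E' f x) {x : M} {u : TangentSpace 𝓘(ℝ, E) x}
    (hu : u ∈ horiz E E' f x) : η x u = 0 := by
  rw [← inner_leeVector, inner_horiz_vert hu (hLee x)]

/-- The vertical part of `∇_X Y` for horizontal fields `X`, `Y`; the last two terms are symmetric
in `X` and `Y`. -/
theorem inner_leviCivita_horiz_vert (hJ : IsLCKWithLeeForm J η)
    (hf : IsAntiInvariantSubmersion E E' J f) (hLee : ∀ x, leeVector η x ∈ vert E E' f x)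
    (sX : IsSmoothField X) (sY : IsSmoothField Y) (sV : IsSmoothField V)
    (hX : ∀ x, X x ∈ horiz E E' f x) (hY : ∀ x, Y x ∈ horiz E E' f x)
    (hV : ∀ x, V x ∈ vert E E' f x) (x : M) :
    ⟪leviCivita Y x (X x), V x⟫_ℝ
      = ⟪oneillA E E' f X (compB E E' J f Y) x, J x (V x)⟫_ℝ
        - ⟪compC E E' J f Y x, J x (oneillA E E' f X V x)⟫_ℝ
        - (1 / 2) * ⟪compB E E' J f Y x, leeVector η x⟫_ℝ * ⟪X x, J x (V x)⟫_ℝ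
        - (1 / 2) * η x (V x) * ⟪X x, Y x⟫_ℝ
        + (1 / 2) * η x (V x) * ⟪compC E E' J f X x, compC E E' J f Y x⟫_ℝ := by
  have H := hJ.hermitian
  have sJY := H.isSmoothField_endoApply sY
  have sJV := H.isSmoothField_endoApply sV
  have sB : IsSmoothField (compB E E' J f Y) := isSmoothField_vProj hf.riemannian sJY
  have sC : IsSmoothField (compC E E' J f Y) := isSmoothField_hProj hf.riemannian sJY
  have hB : ∀ x, compB E E' J f Y x ∈ vert E E' f x := vProj_mem f _
  have hC : ∀ x, compC E E' J f Y x ∈ horiz E E' f x := hProj_mem f _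
  have hJV : ∀ x, J x (V x) ∈ horiz E E' f x := fun x => hf.antiInvariant x _ (hV x)
  -- The two `∇J` terms: `d1` is the error in moving `J` past `∇_X` on `Y`, `d2` the one on `V`,
  -- paired with `CY`.
  have d1 := hJ.inner_covDerivEndo sX sY sJV x
  have d2 := hJ.inner_covDerivEndo sX sV sC x
  have hηJY : η x (J x (Y x)) = ⟪compB E E' J f Y x, leeVector η x⟫_ℝ := by
    rw [← inner_leeVector]; exact (inner_vProj_left f (endoApply J Y) (hLee x)).symm
  -- Skewness moves `J` onto `X`, and the horizontal vector `CY` sees only the part `CX` of `JX`.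
  have hXJC : ⟪X x, J x (compC E E' J f Y x)⟫_ℝ
      = -⟪compC E E' J f X x, compC E E' J f Y x⟫_ℝ := by
    have h := inner_hProj_left f (endoApply J X) (hC x)
    rw [endoApply, H.inner_map_left] at h
    rw [← neg_eq_iff_eq_neg]
    exact h.symm
  have z1 := IsLCKWithLeeForm.lee_eq_zero_of_horiz hLee (hY x)
  have z2 := IsLCKWithLeeForm.lee_eq_zero_of_horiz hLee (hJV x)
  have z3 := IsLCKWithLeeForm.lee_eq_zero_of_horiz hLee (hC x)
  have z4 := inner_horiz_vert (hX x) (hV x)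
  simp only [endoApply, H.sq, map_neg, inner_neg_right, hηJY, z1, z2, z4] at d1
  simp only [hXJC, z2, z3, z4] at d2
  have a1 : ⟪oneillA E E' f X (compB E E' J f Y) x, J x (V x)⟫_ℝ
      = ⟪leviCivita (compB E E' J f Y) x (X x), J x (V x)⟫_ℝ := by
    rw [oneillA_of_vert hX hB, inner_hProj_left f _ (hJV x)]
  have a2 : ⟪compC E E' J f Y x, J x (oneillA E E' f X V x)⟫_ℝ
      = ⟪compC E E' J f Y x, J x (leviCivita V x (X x))⟫_ℝ := by
    -- Only the horizontal part of `∇_X V` matters, since `J` sends its vertical part into `J (ker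
    -- f_*)`, which is orthogonal to `CY`.
    rw [oneillA_of_vert hX hV]
    conv_rhs => rw [← starProjection_vert_add_horiz (E' := E') f x (leviCivita V x (X x)), map_add,
      inner_add_right,
      inner_compC_map_vert H hf hY ((vert E E' f x).starProjection_apply_mem _), zero_add]
    rfl
  have m := leviCivita_metric (sX.mdifferentiableAt x) (sC.mdifferentiableAt x)
    (sJV.mdifferentiableAt x)
  -- `g(CY, JV)` vanishes identically, so the metric property gives `g(∇_X CY, JV) = -g(CY, ∇_X
  -- JV)`.
  have e : (fun q => ⟪compC E E' J f Y q, endoApply J V q⟫_ℝ) = fun _ => 0 :=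
    funext fun q => inner_compC_map_vert H hf hY (hV q)
  rw [e, mvfderiv_const, zero_apply] at m
  have add : leviCivita (endoApply J Y) x (X x) = leviCivita (compB E E' J f Y) x (X x)
      + leviCivita (compC E E' J f Y) x (X x) := by
    have h := (leviCivita (E := E) (M := M)).isCovariantDerivativeOnUniv.add
      (sB.mdifferentiableAt x) (sC.mdifferentiableAt x) (Set.mem_univ x)
    rw [compB_add_compC] at h
    exact congrArg (fun φ => φ (X x)) h
  have k : ⟪leviCivita Y x (X x), V x⟫_ℝ
      = ⟪leviCivita (endoApply J Y) x (X x), J x (V x)⟫_ℝ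
        - ⟪covDerivEndo J X Y x, J x (V x)⟫_ℝ := by
    rw [covDerivEndo, inner_sub_left, H.inner_map]; ring
  have k2 : ⟪compC E E' J f Y x, leviCivita (endoApply J V) x (X x)⟫_ℝ
      = ⟪covDerivEndo J X V x, compC E E' J f Y x⟫_ℝ
        + ⟪compC E E' J f Y x, J x (leviCivita V x (X x))⟫_ℝ := by
    rw [covDerivEndo, inner_sub_left,
      real_inner_comm (compC E E' J f Y x) (J x (leviCivita V x (X x))),
      real_inner_comm (compC E E' J f Y x) (leviCivita (endoApply J V) x (X x))]
    ring
  rw [k2] at m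
  simp only [endoApply] at m
  rw [k, add, inner_add_left, a1, a2]
  linarith

/-- The vertical part of the bracket of two horizontal fields. -/
theorem inner_mlieBracket_horiz_vert (hJ : IsLCKWithLeeForm J η)
    (hf : IsAntiInvariantSubmersion E E' J f) (hLee : ∀ x, leeVector η x ∈ vert E E' f x)
    (sX : IsSmoothField X) (sY : IsSmoothField Y) (sV : IsSmoothField V)
    (hX : ∀ x, X x ∈ horiz E E' f x) (hY : ∀ x, Y x ∈ horiz E E' f x)
    (hV : ∀ x, V x ∈ vert E E' f x) (x : M) :
    ⟪VectorField.mlieBracket 𝓘(ℝ, E) X Y x, V x⟫_ℝ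
      = -⟪oneillA E E' f Y (compB E E' J f X) x - oneillA E E' f X (compB E E' J f Y) x,
          J x (V x)⟫_ℝ
        - ⟪compC E E' J f Y x, J x (oneillA E E' f X V x)⟫_ℝ
        + ⟪compC E E' J f X x, J x (oneillA E E' f Y V x)⟫_ℝ
        - (1 / 2) * ⟪compB E E' J f Y x, leeVector η x⟫_ℝ * ⟪X x, J x (V x)⟫_ℝ
        + (1 / 2) * ⟪compB E E' J f X x, leeVector η x⟫_ℝ * ⟪Y x, J x (V x)⟫_ℝ := by
  have h1 := inner_leviCivita_horiz_vert hJ hf hLee sX sY sV hX hY hV x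
  have h2 := inner_leviCivita_horiz_vert hJ hf hLee sY sX sV hY hX hV x
  -- Puts the terms symmetric in `X, Y` in the same form, so that they cancel in the difference.
  rw [real_inner_comm (X x) (Y x), real_inner_comm (compC E E' J f X x)] at h2
  rw [← leviCivita_torsion (sX.mdifferentiableAt x) (sY.mdifferentiableAt x), inner_sub_left,
    inner_sub_left]
  linarith

theorem mem_horiz_iff_vProj_eq_zero (X : Π x : M, TangentSpace 𝓘(ℝ, E) x) (x : M) :
    X x ∈ horiz E E' f x ↔ vProj E E' f X x = 0 :=
  (vert E E' f x).starProjection_apply_eq_zero_iff.symm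

/-- The horizontal distribution is integrable iff brackets of horizontal fields are orthogonal
to all vertical fields. -/
theorem isIntegrable_horiz_iff (hf : IsRiemannianSubmersion E E' f) :
    IsIntegrable (horiz E E' f) ↔ ∀ X Y V : Π x : M, TangentSpace 𝓘(ℝ, E) x,
      IsSmoothField X → IsSmoothField Y → IsSmoothField V →
      (∀ x, X x ∈ horiz E E' f x) → (∀ x, Y x ∈ horiz E E' f x) →
      (∀ x, V x ∈ vert E E' f x) → ∀ x,
        ⟪VectorField.mlieBracket 𝓘(ℝ, E) X Y x, V x⟫_ℝ = 0 := by
  refine ⟨fun h X Y V sX sY _ hX hY hV x => inner_horiz_vert (h X Y sX sY hX hY x) (hV x),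
    fun h X Y sX sY hX hY x => ?_⟩
  -- The test field is the vertical part of `[X, Y]` itself, which is smooth; its squared length is
  -- its pairing with the bracket.
  rw [mem_horiz_iff_vProj_eq_zero, ← inner_self_eq_zero (𝕜 := ℝ),
    inner_vProj_left f _ (vProj_mem f _ x)]
  exact h X Y _ sX sY (isSmoothField_vProj hf (isSmoothField_mlieBracket sX sY)) hX hY
    (vProj_mem f _) x

end Submersion

end RiemSubm

end

theorem theorem3p3
    {E : Type*} [NormedAddCommGroup E] [NormedSpace ℝ E] [FiniteDimensional ℝ E]
    {M : Type*} [TopologicalSpace M] [T2Space M] [SecondCountableTopology M]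
    [ChartedSpace E M] [IsManifold 𝓘(ℝ, E) ∞ M]
    [RiemannianBundle (fun x : M => TangentSpace 𝓘(ℝ, E) x)]
    [IsContMDiffRiemannianBundle 𝓘(ℝ, E) ∞ E (fun x : M => TangentSpace 𝓘(ℝ, E) x)]
    {E' : Type*} [NormedAddCommGroup E'] [NormedSpace ℝ E'] [FiniteDimensional ℝ E']
    {N : Type*} [TopologicalSpace N] [T2Space N] [SecondCountableTopology N]
    [ChartedSpace E' N] [IsManifold 𝓘(ℝ, E') ∞ N]
    [RiemannianBundle (fun x : N => TangentSpace 𝓘(ℝ, E') x)]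
    [IsContMDiffRiemannianBundle 𝓘(ℝ, E') ∞ E' (fun x : N => TangentSpace 𝓘(ℝ, E') x)]
    (J : Π x : M, TangentSpace 𝓘(ℝ, E) x →L[ℝ] TangentSpace 𝓘(ℝ, E) x)
    (η : Π x : M, TangentSpace 𝓘(ℝ, E) x →L[ℝ] ℝ)
    (hJ : RiemSubm.IsLCKWithLeeForm J η)
    (f : M → N)
    (hf : RiemSubm.IsAntiInvariantSubmersion E E' J f)
    (hLee : ∀ x, RiemSubm.leeVector η x ∈ RiemSubm.vert E E' f x) :
    List.TFAE [
      RiemSubm.IsIntegrable (RiemSubm.horiz E E' f),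
      ∀ X Y V : Π x : M, TangentSpace 𝓘(ℝ, E) x,
        RiemSubm.IsSmoothField X → RiemSubm.IsSmoothField Y → RiemSubm.IsSmoothField V →
        (∀ x, X x ∈ RiemSubm.horiz E E' f x) → (∀ x, Y x ∈ RiemSubm.horiz E E' f x) →
        (∀ x, V x ∈ RiemSubm.vert E E' f x) → ∀ x,
          ⟪RiemSubm.secondFundForm E E' f Y (RiemSubm.compB E E' J f X) x,
              RiemSubm.diff E E' f x (J x (V x))⟫_ℝ
            = ⟪RiemSubm.secondFundForm E E' f X (RiemSubm.compB E E' J f Y) x,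
                RiemSubm.diff E E' f x (J x (V x))⟫_ℝ
              + ⟪RiemSubm.compC E E' J f Y x, J x (RiemSubm.oneillA E E' f X V x)⟫_ℝ
              - ⟪RiemSubm.compC E E' J f X x, J x (RiemSubm.oneillA E E' f Y V x)⟫_ℝ
              + (1 / 2) * ⟪RiemSubm.compB E E' J f Y x, RiemSubm.leeVector η x⟫_ℝ
                  * ⟪X x, J x (V x)⟫_ℝ
              - (1 / 2) * ⟪RiemSubm.compB E E' J f X x, RiemSubm.leeVector η x⟫_ℝ
                  * ⟪Y x, J x (V x)⟫_ℝ,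
      ∀ X Y V : Π x : M, TangentSpace 𝓘(ℝ, E) x,
        RiemSubm.IsSmoothField X → RiemSubm.IsSmoothField Y → RiemSubm.IsSmoothField V →
        (∀ x, X x ∈ RiemSubm.horiz E E' f x) → (∀ x, Y x ∈ RiemSubm.horiz E E' f x) →
        (∀ x, V x ∈ RiemSubm.vert E E' f x) → ∀ x,
          ⟪RiemSubm.oneillA E E' f Y (RiemSubm.compB E E' J f X) x
              - RiemSubm.oneillA E E' f X (RiemSubm.compB E E' J f Y) x, J x (V x)⟫_ℝ
            = - ⟪RiemSubm.compC E E' J f Y x, J x (RiemSubm.oneillA E E' f X V x)⟫_ℝ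
              + ⟪RiemSubm.compC E E' J f X x, J x (RiemSubm.oneillA E E' f Y V x)⟫_ℝ
              - (1 / 2) * ⟪RiemSubm.compB E E' J f Y x, RiemSubm.leeVector η x⟫_ℝ
                  * ⟪X x, J x (V x)⟫_ℝ
              + (1 / 2) * ⟪RiemSubm.compB E E' J f X x, RiemSubm.leeVector η x⟫_ℝ
                  * ⟪Y x, J x (V x)⟫_ℝ] := by
  have key := RiemSubm.isIntegrable_horiz_iff hf.riemannian
  have hbr := @RiemSubm.inner_mlieBracket_horiz_vert E _ _ _ M _ _ _ _ _ E' _ _ _ N _ _ _ _ _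
    J η f
  -- By `hbr`, the pairing of `[X, Y]` with `V` is exactly the right side of (c) minus the left
  -- side.
  tfae_have 1 ↔ 3 := by
    refine key.trans ⟨fun h X Y V sX sY sV hX hY hV x => ?_, fun h X Y V sX sY sV hX hY hV x => ?_⟩
    all_goals
      have h1 := h X Y V sX sY sV hX hY hV x
      have h2 := hbr hJ hf hLee sX sY sV hX hY hV x
      linarith
  -- Field by field, each `∇π_*` term in (b) is minus the matching `A` term, so (b) is (c)
  -- multiplied by `-1` and rearranged.
  tfae_have 2 ↔ 3 := by
    refine ⟨fun h X Y V sX sY sV hX hY hV x => ?_, fun h X Y V sX sY sV hX hY hV x => ?_⟩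
    all_goals
      have h1 := h X Y V sX sY sV hX hY hV x
      have h2 := RiemSubm.inner_secondFundForm_compB (Y := X) hf hY hV x
      have h3 := RiemSubm.inner_secondFundForm_compB (Y := Y) hf hX hV x
      rw [inner_sub_left] at *
      linarith
  tfae_finish
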